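/- Let $k$ be a field. All schemes are separated schemes over $\operatorname{Spec}(k)$, and morphisms and products of schemes are taken over $\operatorname{Spec}(k)$. An algebraic group is a group scheme of finite type over $k$ (not assumed smooth or reduced). An action of a group scheme $G$ on a scheme $Z$ is a morphism $G \times Z \to Z$ that is associative with respect to the multiplication of $G$ and for which the neutral element acts as the identity. Let $G$ be a connected algebraic group, let $X$ be a scheme of finite type equipped with an action $a : G \times X \to X$ of $G$, let $Y$ be a scheme of finite type, and let $f : X \to Y$ be a proper morphism such that the map $f^{\#} : \mathcal{O}_Y \to f_*(\mathcal{O}_X)$ is an isomorphism. Then there exists a unique action $b : G \times Y \to Y$ of $G$ on $Y$ such that $f$ is equivariant, i.e., such that $f \circ a = b \circ (\mathrm{id}_G \times f)$. -/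

import Mathlib

open CategoryTheory AlgebraicGeometry

universe u

namespace AlgebraicGeometry

open Limits TopologicalSpace Opposite

/-! Since `f` is proper with `f_* 𝒪_X = 𝒪_Y`, so is `G ◁ f`, by flat base change. Such a morphism is
an epimorphism, and any morphism constant on its fibres factors through it
(`OConnected.exists_comp_eq`). So it suffices that `g x` and `g x'` have the same image in `Y`
whenever `x` and `x'` do; uniqueness of `b` and the action axioms then follow by cancelling
epimorphisms. It is enough to test this at closed points, over a finite extension `T` of `k`. The
locus of `g` in `G ⊗ T` where `f (g x) = f (g x')` is closed, as `Y` is separated, and contains the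
identity. Near the identity the action does descend (`exists_nhd_unitSection`), and translation
makes the locus open. As `G ⊗ T` is connected, it is everything. -/

/-- A morphism of schemes `p : A ⟶ B` is `𝒪`-connected if `𝒪_B ⟶ p_* 𝒪_A` is an isomorphism. -/
class OConnected {A B : Scheme.{u}} (p : A ⟶ B) : Prop where
  isIso_app (U : B.Opens) : IsIso (p.app U)

/-! ### Factorization through proper `𝒪`-connected morphisms -/

namespace OConnected

variable {A B : Scheme.{u}} (p : A ⟶ B)

instance [OConnected p] (U : B.Opens) : IsIso (p.app U) := isIso_app U

lemma of_isIso_c (h : IsIso p.c) : OConnected p :=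
  ⟨fun U ↦ NatIso.isIso_app_of_isIso p.c (op U)⟩

lemma of_isBasis {ι : Type*} (U : ι → B.Opens) (hU : Opens.IsBasis (Set.range U))
    (h : ∀ i, IsIso (p.app (U i))) : OConnected p := by
  let φ : B.sheaf ⟶ (TopCat.Sheaf.pushforward _ p.base).obj A.sheaf := ⟨p.c⟩
  have : IsIso φ := TopCat.Sheaf.isIso_iff_isIso_basis hU h
  have : IsIso ((TopCat.Sheaf.forget _ _).map φ) := inferInstance
  exact of_isIso_c p this

instance [OConnected p] (W : B.Opens) : OConnected (p ∣_ W) := by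
  refine ⟨fun V ↦ ?_⟩
  rw [morphismRestrict_app]
  exact IsIso.comp_isIso' (isIso_app _) (Functor.map_isIso _ _)

lemma app_injective [OConnected p] (U : B.Opens) : Function.Injective (p.app U) :=
  ((ConcreteCategory.isIso_iff_bijective _).mp (isIso_app U)).1

instance [OConnected p] [QuasiCompact p] : IsSchemeTheoreticallyDominant p := by
  refine ⟨Scheme.IdealSheafData.ext (funext fun U ↦ ?_)⟩
  rw [Scheme.Hom.ker_apply, (RingHom.injective_iff_ker_eq_bot _).mp (app_injective p U)]
  rfl

instance [OConnected p] [IsProper p] : Surjective p :=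
  ⟨by
    have h := p.isClosedMap.isClosed_range.closure_eq
    rw [p.denseRange.closure_range] at h
    exact Set.range_eq_univ.mp h.symm⟩

/-- Surjectivity determines a morphism out of `B` on points; injectivity of `𝒪_B ⟶ p_* 𝒪_A`
determines it on functions. -/
lemma epi [OConnected p] [Surjective p] : Epi p := by
  refine ⟨fun {Z} u v huv ↦ ?_⟩
  have hb : u.base = v.base := by
    ext b
    obtain ⟨a, rfl⟩ := p.surjective b
    exact congr($huv a)
  refine Scheme.Hom.ext hb fun U ↦ ?_
  have e : v ⁻¹ᵁ U ≤ u ⁻¹ᵁ U := (congr((Opens.map $hb.symm).obj U)).le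
  have key : u.appLE U (v ⁻¹ᵁ U) e = v.appLE U (v ⁻¹ᵁ U) le_rfl := by
    rw [← cancel_mono (p.app (v ⁻¹ᵁ U)), Scheme.Hom.app_eq_appLE, Scheme.Hom.appLE_comp_appLE,
      Scheme.Hom.appLE_comp_appLE]
    simp only [huv]
  rw [← Scheme.Hom.app_eq_appLE] at key
  exact key

/-- Flat base change for sections, tested on affine opens of `B'` lying over affine opens of `B`. -/
lemma of_isPullback {A' B' : Scheme.{u}} {g' : A' ⟶ A} {p' : A' ⟶ B'} {p : A ⟶ B} {g : B' ⟶ B}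
    (H : IsPullback g' p' p g) [OConnected p] [QuasiCompact p] [QuasiSeparated p] [Flat g] :
    OConnected p' := by
  let ι := {UV : B.affineOpens × B'.affineOpens // UV.2.1 ≤ g ⁻¹ᵁ UV.1.1}
  refine of_isBasis p' (fun i : ι ↦ i.1.2.1) ?_ ?_
  · rw [Opens.isBasis_iff_nbhd]
    intro W x hx
    obtain ⟨_, ⟨U, hU, rfl⟩, hxU, -⟩ :=
      B.isBasis_affineOpens.exists_subset_of_mem_open (Set.mem_univ (g x)) isOpen_univ
    obtain ⟨_, ⟨V, hV, rfl⟩, hxV, hVU⟩ :=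
      B'.isBasis_affineOpens.exists_subset_of_mem_open
        (show x ∈ ((W ⊓ g ⁻¹ᵁ U : B'.Opens) : Set B') from ⟨hx, hxU⟩) (W ⊓ g ⁻¹ᵁ U).2
    exact ⟨V, ⟨⟨⟨⟨U, hU⟩, ⟨V, hV⟩⟩, fun y hy ↦ (hVU hy).2⟩, rfl⟩, hxV, fun y hy ↦ (hVU hy).1⟩
  · rintro ⟨⟨⟨U, hU⟩, ⟨V, hV⟩⟩, hVU⟩
    dsimp at hVU ⊢
    have hle : p' ⁻¹ᵁ V ≤ g' ⁻¹ᵁ (p ⁻¹ᵁ U) := by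
      rw [← Scheme.Hom.comp_preimage, H.w, Scheme.Hom.comp_preimage]
      exact p'.preimage_mono hVU
    have := (isIso_pushoutSection_iff H hVU le_rfl (inf_eq_right.mpr hle).symm).mp
      (isIso_pushoutSection_of_isQuasiSeparated_of_flat_right H hVU le_rfl
        (inf_eq_right.mpr hle).symm hU hV (p.isCompact_preimage hU.isCompact)
        (p.isQuasiSeparated_preimage hU.isQuasiSeparated))
    rw [Scheme.Hom.app_eq_appLE]
    exact this.isIso_inr_of_isIso (by rw [← Scheme.Hom.app_eq_appLE]; infer_instance)

/-- If a morphism maps a fibre of a proper `𝒪`-connected morphism `p` into an affine open, then it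
factors through `p` over a neighborhood of the base point of that fibre. -/
lemma exists_restrict_comp_eq [OConnected p] [IsProper p] {Y : Scheme.{u}} (h : A ⟶ Y) (z : B)
    (V : Y.Opens) (hV : IsAffineOpen V) (hz : ∀ a, p a = z → h a ∈ V) :
    ∃ (W : B.Opens) (b : W.toScheme ⟶ Y), z ∈ W ∧ (p ∣_ W) ≫ b = (p ⁻¹ᵁ W).ι ≫ h := by
  -- The points whose whole fibre goes into `V`; open because `p` is closed.
  let W : B.Opens := ⟨(p '' (h ⁻¹ᵁ V : A.Opens)ᶜ)ᶜ,
    (p.isClosedMap _ (h ⁻¹ᵁ V).2.isClosed_compl).isOpen_compl⟩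
  have hW : Set.range ((p ⁻¹ᵁ W).ι ≫ h) ⊆ Set.range V.ι := by
    rintro _ ⟨a, rfl⟩
    rw [Scheme.Opens.range_ι]
    by_contra hn
    exact a.2 ⟨a.1, hn, rfl⟩
  have : IsAffine V.toScheme := hV
  let h' : (p ⁻¹ᵁ W).toScheme ⟶ V.toScheme := IsOpenImmersion.lift V.ι ((p ⁻¹ᵁ W).ι ≫ h) hW
  have : IsIso (p ∣_ W).appTop := isIso_app (p := p ∣_ W) ⊤
  -- A morphism to the affine `V` is a ring map, and `W` and `p ⁻¹ᵁ W` have the same global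
  -- functions.
  refine ⟨W, W.toScheme.toSpecΓ ≫ Spec.map (h'.appTop ≫ inv (p ∣_ W).appTop) ≫
    V.toScheme.isoSpec.inv ≫ V.ι, ?_, ?_⟩
  · rintro ⟨a, ha, rfl⟩
    exact ha (hz a rfl)
  · rw [Scheme.toSpecΓ_naturality_assoc, ← Spec.map_comp_assoc, Category.assoc,
      IsIso.inv_hom_id, Category.comp_id, ← Scheme.toSpecΓ_naturality_assoc]
    simp [h']

/-- A morphism which is constant on the fibres of a proper `𝒪`-connected morphism factors. -/
lemma exists_comp_eq [OConnected p] [IsProper p] {Y : Scheme.{u}} (h : A ⟶ Y)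
    (hh : ∀ a a', p a = p a' → h a = h a') : ∃ b : B ⟶ Y, p ≫ b = h := by
  have key (z : B) : ∃ (W : B.Opens) (b : W.toScheme ⟶ Y),
      z ∈ W ∧ (p ∣_ W) ≫ b = (p ⁻¹ᵁ W).ι ≫ h := by
    obtain ⟨a, rfl⟩ := p.surjective z
    obtain ⟨_, ⟨V, hV, rfl⟩, hxV, -⟩ :=
      Y.isBasis_affineOpens.exists_subset_of_mem_open (Set.mem_univ (h a)) isOpen_univ
    exact exists_restrict_comp_eq p h _ V hV fun a' ha' ↦ hh _ _ ha' ▸ hxV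
  choose W b hW hb using key
  have hcov : IsOpenCover W := IsOpenCover.mk (top_le_iff.mp fun z _ ↦ Opens.mem_iSup.mpr ⟨z, hW z⟩)
  let 𝒰 := B.openCoverOfIsOpenCover W hcov
  have hcompat (x y : B) : B.homOfLE (inf_le_left : W x ⊓ W y ≤ W x) ≫ b x =
      B.homOfLE (inf_le_right : W x ⊓ W y ≤ W y) ≫ b y := by
    have : Epi (p ∣_ (W x ⊓ W y)) := epi _
    rw [← cancel_epi (p ∣_ (W x ⊓ W y))]
    have aux (W' W'' : B.Opens) (hle : W' ≤ W'') : (p ∣_ W') ≫ B.homOfLE hle =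
        A.homOfLE (p.preimage_mono hle) ≫ p ∣_ W'' := by
      simp [← cancel_mono W''.ι]
    rw [reassoc_of% aux, reassoc_of% aux, hb, hb]
    simp
  have hglue (x y : B) : pullback.fst (W x).ι (W y).ι ≫ b x = pullback.snd _ _ ≫ b y := by
    have H := isPullback_opens_inf (W x) (W y)
    rw [← cancel_epi H.isoPullback.hom]
    simpa using hcompat x y
  refine ⟨𝒰.glueMorphisms b hglue, ?_⟩
  refine (A.openCoverOfIsOpenCover _ (hcov.comap p.base.hom)).hom_ext _ _ fun x ↦ ?_
  have hι : (W x).ι ≫ 𝒰.glueMorphisms b hglue = b x := 𝒰.ι_glueMorphisms b hglue x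
  change (p ⁻¹ᵁ W x).ι ≫ p ≫ _ = (p ⁻¹ᵁ W x).ι ≫ h
  rw [← morphismRestrict_ι_assoc, hι]
  exact hb x

end OConnected

end AlgebraicGeometry

namespace CategoryTheory

open Limits MonoidalCategory CartesianMonoidalCategory
open scoped CategoryTheory.MonObj

/-! ### Unit section and translations in a cartesian monoidal category -/

section CartesianMonoidal

variable {C : Type*} [Category* C] [CartesianMonoidalCategory C]

lemma isPullback_snd_whiskerLeft (T : C) {X Y : C} (f : X ⟶ Y) :
    IsPullback (snd T X) (T ◁ f) f (snd T Y) where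
  w := by simp
  isLimit' := ⟨PullbackCone.IsLimit.mk _ (fun s ↦ lift (s.snd ≫ fst T Y) s.fst)
    (fun s ↦ by simp) (fun s ↦ by ext <;> simp [s.condition])
    (fun s m h₁ h₂ ↦ by ext <;> simp [← h₁, ← h₂])⟩

variable (G : C) [MonObj G]

/-- The section `x ↦ (1, x)` of the projection `G ⊗ X ⟶ X`. -/
def unitSection (X : C) : X ⟶ G ⊗ X := lift (toUnit X ≫ η) (𝟙 X)

@[simp]
lemma unitSection_fst (X : C) : unitSection G X ≫ fst G X = toUnit X ≫ η := by simp [unitSection]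

@[simp]
lemma unitSection_snd (X : C) : unitSection G X ≫ snd G X = 𝟙 X := by simp [unitSection]

lemma unitSection_naturality {X Y : C} (f : X ⟶ Y) :
    unitSection G X ≫ G ◁ f = f ≫ unitSection G Y := by
  ext
  · rw [Category.assoc, whiskerLeft_fst, Category.assoc, unitSection_fst, unitSection_fst,
      comp_toUnit_assoc]
  · rw [Category.assoc, whiskerLeft_snd, Category.assoc, unitSection_snd, Category.comp_id,
      ← Category.assoc, unitSection_snd, Category.id_comp]

@[simp]
lemma unitSection_smul (X : C) [ModObj G X] : unitSection G X ≫ γ[G, X] = 𝟙 X := by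
  have := one_smul (X ⟶ G) (𝟙 X)
  rwa [Hom.smul_def, Hom.one_def] at this

@[simp]
lemma unitSection_smul_comp {X Y : C} [ModObj G X] (f : X ⟶ Y) :
    unitSection G X ≫ γ[G, X] ≫ f = f := by
  rw [← Category.assoc, unitSection_smul, Category.id_comp]

/-- Identifies the fibre of `G ◁ f` over `(1, y)` with that of `f` over `y`. -/
lemma isPullback_unitSection {X Y : C} (f : X ⟶ Y) :
    IsPullback (unitSection G X) f (G ◁ f) (unitSection G Y) := by
  refine IsPullback.of_right ?_ (unitSection_naturality G f) (isPullback_snd_whiskerLeft G f)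
  simpa using IsPullback.of_id_fst

lemma isPullback_unitSection_fst (X : C) :
    IsPullback (unitSection G X) (toUnit X) (fst G X) η where
  w := by simp
  isLimit' := ⟨PullbackCone.IsLimit.mk _ (fun s ↦ s.fst ≫ snd G X)
    (fun s ↦ by
      have := s.condition
      ext
      · rw [this, Category.assoc, unitSection_fst, ← Category.assoc]
        congr 1
        exact toUnit_unique _ _
      · simp)
    (fun s ↦ toUnit_unique _ _)
    (fun s m h₁ h₂ ↦ by simp [← h₁])⟩

end CartesianMonoidal

section Group

variable {C : Type*} [Category* C] [CartesianMonoidalCategory C] (G : C) [GrpObj G]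

/-- The automorphism `(g', l) ↦ (g' * g l, l)` of `G ⊗ L` attached to a point `g : L ⟶ G`. -/
def rightTranslation {L : C} (g : L ⟶ G) : G ⊗ L ≅ G ⊗ L where
  hom := lift (fst G L * snd G L ≫ g) (snd G L)
  inv := lift (fst G L * (snd G L ≫ g)⁻¹) (snd G L)
  hom_inv_id := by ext <;> simp [MonObj.comp_mul, GrpObj.comp_inv]
  inv_hom_id := by ext <;> simp [MonObj.comp_mul]

lemma unitSection_rightTranslation_hom {L : C} (g : L ⟶ G) :
    unitSection G L ≫ (rightTranslation G g).hom = lift g (𝟙 L) := by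
  have : toUnit L ≫ η[G] = 1 := rfl
  ext <;> simp [rightTranslation, MonObj.comp_mul, this, reassoc_of% unitSection_snd G L]

lemma rightTranslation_smul {L X : C} [ModObj G X] (g : L ⟶ G) (x : L ⟶ X) :
    (rightTranslation G g).hom ≫ G ◁ x ≫ γ[G, X] = G ◁ (g • x) ≫ γ[G, X] := by
  have h₁ : (rightTranslation G g).hom ≫ G ◁ x ≫ γ[G, X] =
      (fst G L * snd G L ≫ g) • (snd G L ≫ x) := by
    rw [Hom.smul_def, ← Category.assoc]
    congr 1
    ext <;> simp [rightTranslation]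
  have h₂ : G ◁ (g • x) ≫ γ[G, X] = fst G L • (snd G L ≫ (g • x)) := by
    rw [Hom.smul_def]
    congr 1
    ext <;> simp
  rw [h₁, h₂, mul_smul, ModObj.comp_smul]

/-- For `σ = (g, t)` this is `(g' * g) • x(t) = g' • (g • x(t))`: translation moves the point `σ` to
the unit section. -/
lemma rightTranslation_comp_smul {L T X : C} [ModObj G X] (σ : L ⟶ G ⊗ T) (x : T ⟶ X) :
    ((rightTranslation G (σ ≫ fst G T)).hom ≫ G ◁ (σ ≫ snd G T)) ≫ G ◁ x ≫ γ[G, X] =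
      G ◁ (σ ≫ G ◁ x ≫ γ[G, X]) ≫ γ[G, X] := by
  have h : σ ≫ G ◁ x ≫ γ[G, X] = (σ ≫ fst G T) • (σ ≫ snd G T ≫ x) := by
    rw [Hom.smul_def, ← Category.assoc]
    congr 1
    ext <;> simp
  rw [h, ← rightTranslation_smul]
  simp

end Group

end CategoryTheory

namespace AlgebraicGeometry

open Limits MonoidalCategory CartesianMonoidalCategory
open scoped CategoryTheory.MonObj

variable {k : Type u} [Field k]

/-! ### Products over the field, and connectedness -/

section Products

variable (T : Over (Spec (.of k))) {X Y : Over (Spec (.of k))} (f : X ⟶ Y)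

lemma isPullback_whiskerLeft_left :
    IsPullback (snd T X).left (T ◁ f).left f.left (snd T Y).left :=
  (isPullback_snd_whiskerLeft T f).map (Over.forget _)

instance flat_snd_left : Flat (snd T Y).left := by
  have : Flat T.hom := inferInstance
  exact inferInstanceAs (Flat (pullback.snd T.hom Y.hom))

instance isProper_whiskerLeft_left [IsProper f.left] : IsProper (T ◁ f).left :=
  MorphismProperty.of_isPullback (isPullback_whiskerLeft_left T f) ‹_›

instance oConnected_whiskerLeft_left [IsProper f.left] [OConnected f.left] :
    OConnected (T ◁ f).left :=
  .of_isPullback (isPullback_whiskerLeft_left T f)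

lemma epi_of_oConnected [IsProper f.left] [OConnected f.left] : Epi f :=
  have := OConnected.epi f.left
  Over.epi_of_epi_left f

end Products

section Connected

variable (G : Over (Spec (.of k))) [MonObj G]

/-- Connectedness of a monoid scheme with a rational point is preserved by integral base change. -/
lemma eq_univ_of_isClopen [ConnectedSpace G.left] (T : Over (Spec (.of k))) [IsIntegralHom T.hom]
    [Subsingleton T.left] (C : Set (G ⊗ T).left) (hC : IsClopen C) (t : T.left)
    (ht : (unitSection G T).left t ∈ C) : C = Set.univ := by
  have : IsIntegralHom (fst G T).left := inferInstanceAs (IsIntegralHom (pullback.fst G.hom T.hom))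
  have : UniversallyOpen (fst G T).left :=
    inferInstanceAs (UniversallyOpen (pullback.fst G.hom T.hom))
  by_contra hne
  -- The projection to `G` is open and closed, so a nonempty complement would surject onto `G` and
  -- meet the fibre over the identity, which is only the point `(1, t)`.
  have hD : IsClopen ((fst G T).left '' Cᶜ) :=
    ⟨(fst G T).left.isClosedMap _ hC.compl.1, (fst G T).left.isOpenMap _ hC.compl.2⟩
  have huniv := hD.eq_univ ((Set.nonempty_compl.mpr hne).image _)
  let pt : (𝟙_ (Over (Spec (.of k)))).left := (toUnit T).left t
  obtain ⟨c, hc, hce⟩ : η[G].left pt ∈ (fst G T).left '' Cᶜ := huniv ▸ Set.mem_univ _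
  have H := (isPullback_unitSection_fst G T).map (Over.forget _)
  obtain ⟨t', ht', -⟩ := Scheme.exists_preimage_of_isPullback H c pt hce
  obtain rfl := Subsingleton.elim t t'
  exact hc (ht' ▸ ht)

end Connected

/-! ### The action on fibres of `f` -/

section Neighborhood

variable (G : Over (Spec (.of k))) [MonObj G] {X Y : Over (Spec (.of k))} [ModObj G X]
  (f : X ⟶ Y) [IsProper f.left] [OConnected f.left]

/-- The action followed by `f` sends the fibre of `G ◁ f` over `(1, y)` to `y`, hence into an affine
open, so it factors through `G ◁ f` near `(1, y)`. -/
lemma exists_nhd_unitSection (y : Y.left) :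
    ∃ W : (G ⊗ Y).left.Opens, (unitSection G Y).left y ∈ W ∧
      ∀ (Z : Scheme.{u}) (a a' : Z ⟶ (G ⊗ X).left), a ≫ (G ◁ f).left = a' ≫ (G ◁ f).left →
        (∀ z, (a ≫ (G ◁ f).left) z ∈ W) → a ≫ (γ[G, X] ≫ f).left = a' ≫ (γ[G, X] ≫ f).left := by
  obtain ⟨_, ⟨V, hV, rfl⟩, hyV, -⟩ :=
    Y.left.isBasis_affineOpens.exists_subset_of_mem_open (Set.mem_univ y) isOpen_univ
  have H : IsPullback (unitSection G X).left f.left (G ◁ f).left (unitSection G Y).left :=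
    (isPullback_unitSection G f).map (Over.forget _)
  obtain ⟨W, b, hW, hb⟩ := OConnected.exists_restrict_comp_eq (G ◁ f).left (γ[G, X] ≫ f).left
    ((unitSection G Y).left y) V hV (by
      intro a ha
      obtain ⟨x, rfl, rfl⟩ := Scheme.exists_preimage_of_isPullback H a y ha
      have h : (γ[G, X] ≫ f).left ((unitSection G X).left x) = f.left x := by
        rw [← Scheme.Hom.comp_apply, ← Over.comp_left, unitSection_smul_comp]
      exact h ▸ hyV)
  refine ⟨W, hW, fun Z a a' haa' ha ↦ ?_⟩
  have hr : Set.range a ⊆ Set.range ((G ◁ f).left ⁻¹ᵁ W).ι := by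
    rintro _ ⟨z, rfl⟩
    rw [Scheme.Opens.range_ι]
    exact ha z
  have hr' : Set.range a' ⊆ Set.range ((G ◁ f).left ⁻¹ᵁ W).ι := by
    rintro _ ⟨z, rfl⟩
    rw [Scheme.Opens.range_ι]
    exact (haa' ▸ ha) z
  rw [← IsOpenImmersion.lift_fac _ a hr, ← IsOpenImmersion.lift_fac _ a' hr', Category.assoc,
    Category.assoc, ← hb, ← Category.assoc, ← Category.assoc]
  congr 1
  rw [← cancel_mono W.ι]
  simpa

end Neighborhood

section Action

variable (G : Over (Spec (.of k))) [GrpObj G]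
  {X Y : Over (Spec (.of k))} [ModObj G X] (f : X ⟶ Y)

variable [IsProper f.left] [OConnected f.left]

/-- Openness of the locus: `s = (g, t)` yields points `g x`, `g x'` with equal image in `Y`, to
which the neighbourhood of the identity applies; translating back gives one of `s`. -/
lemma exists_isOpen_mem_range_equalizer {T : Over (Spec (.of k))} [Subsingleton T.left]
    [IsIntegral T.left] (x x' : T ⟶ X) (s : (G ⊗ T).left)
    (hs : s ∈ Set.range (equalizer.ι (G ◁ x ≫ γ[G, X] ≫ f) (G ◁ x' ≫ γ[G, X] ≫ f)).left) :
    ∃ U : Set (G ⊗ T).left, IsOpen U ∧ s ∈ U ∧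
      U ⊆ Set.range (equalizer.ι (G ◁ x ≫ γ[G, X] ≫ f) (G ◁ x' ≫ γ[G, X] ≫ f)).left := by
  set v := G ◁ x ≫ γ[G, X] ≫ f with hv
  set v' := G ◁ x' ≫ γ[G, X] ≫ f with hv'
  obtain ⟨e, rfl⟩ := hs
  let E := equalizer v v'
  let L : Over (Spec (.of k)) := Over.mk (E.left.fromSpecResidueField e ≫ E.hom)
  let i : L ⟶ E := Over.homMk (E.left.fromSpecResidueField e) rfl
  let pt : L.left := IsLocalRing.closedPoint _
  have hpt : i.left pt = e := E.left.fromSpecResidueField_apply e pt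
  let σ : L ⟶ G ⊗ T := i ≫ equalizer.ι v v'
  have hσ : σ ≫ v = σ ≫ v' := by
    simpa [σ] using congr(i ≫ $(equalizer.condition v v'))
  let z := σ ≫ G ◁ x ≫ γ[G, X]
  let z' := σ ≫ G ◁ x' ≫ γ[G, X]
  have hz : z ≫ f = z' ≫ f := by simpa [z, z', v, v'] using hσ
  let τ : G ⊗ L ⟶ G ⊗ T := (rightTranslation G (σ ≫ fst G T)).hom ≫ G ◁ (σ ≫ snd G T)
  have hτ (x : T ⟶ X) : τ ≫ G ◁ x ≫ γ[G, X] = G ◁ (σ ≫ G ◁ x ≫ γ[G, X]) ≫ γ[G, X] :=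
    rightTranslation_comp_smul G σ x
  -- `T` is the spectrum of a field, so `L ⟶ T` is universally open; the translation is an
  -- isomorphism.
  have hτopen : UniversallyOpen τ.left := by
    have h₁ : UniversallyOpen (σ ≫ snd G T).left := inferInstance
    have h₂ : UniversallyOpen (G ◁ (σ ≫ snd G T)).left :=
      MorphismProperty.of_isPullback (isPullback_whiskerLeft_left G (σ ≫ snd G T)) h₁
    have h₃ : IsIso (rightTranslation G (σ ≫ fst G T)).hom.left :=
      inferInstanceAs (IsIso ((Over.forget _).map (rightTranslation G (σ ≫ fst G T)).hom))
    rw [Over.comp_left]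
    infer_instance
  obtain ⟨W, hW, hWZ⟩ := exists_nhd_unitSection G f ((z ≫ f).left pt)
  let O : (G ⊗ L).left.Opens := (G ◁ (z ≫ f)).left ⁻¹ᵁ W
  have hO : O.ι ≫ (τ ≫ v).left = O.ι ≫ (τ ≫ v').left := by
    have h₁ : τ ≫ v = G ◁ z ≫ γ[G, X] ≫ f := by
      rw [← reassoc_of% hτ x]
    have h₂ : τ ≫ v' = G ◁ z' ≫ γ[G, X] ≫ f := by
      rw [← reassoc_of% hτ x']
    have e₁ : (O.ι ≫ (G ◁ z).left) ≫ (G ◁ f).left = O.ι ≫ (G ◁ (z ≫ f)).left := by simp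
    have e₂ : (O.ι ≫ (G ◁ z').left) ≫ (G ◁ f).left = O.ι ≫ (G ◁ (z ≫ f)).left := by simp [hz]
    have h := hWZ O (O.ι ≫ (G ◁ z).left) (O.ι ≫ (G ◁ z').left) (e₁.trans e₂.symm)
      fun w ↦ e₁ ▸ w.2
    rw [h₁, h₂]
    simpa using h
  refine ⟨τ.left '' O, τ.left.isOpenMap _ O.2, ⟨(unitSection G L).left pt, ?_, ?_⟩, ?_⟩
  · change (G ◁ (z ≫ f)).left ((unitSection G L).left pt) ∈ W
    rw [← Scheme.Hom.comp_apply, ← Over.comp_left, unitSection_naturality, Over.comp_left,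
      Scheme.Hom.comp_apply]
    exact hW
  · have : unitSection G L ≫ τ = σ := by
      rw [← Category.assoc, unitSection_rightTranslation_hom]
      ext <;> simp
    rw [← Scheme.Hom.comp_apply, ← Over.comp_left, this, Over.comp_left, Scheme.Hom.comp_apply, hpt]
  · rintro _ ⟨w, hw, rfl⟩
    let O' : Over (Spec (.of k)) := Over.mk (O.ι ≫ (G ⊗ L).hom)
    let j : O' ⟶ G ⊗ L := Over.homMk O.ι rfl
    have hj : (j ≫ τ) ≫ v = (j ≫ τ) ≫ v' := by
      ext1
      exact hO
    have hj' := congr($(equalizer.lift_ι _ hj).left (⟨w, hw⟩ : O))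
    refine ⟨(equalizer.lift _ hj).left (⟨w, hw⟩ : O), hj'⟩

lemma surjective_equalizer_ι [ConnectedSpace G.left] [IsSeparated Y.hom]
    {T : Over (Spec (.of k))} [Subsingleton T.left] [IsIntegral T.left] [IsIntegralHom T.hom]
    (x x' : T ⟶ X) (hx : x ≫ f = x' ≫ f) :
    Surjective (equalizer.ι (G ◁ x ≫ γ[G, X] ≫ f) (G ◁ x' ≫ γ[G, X] ≫ f)).left := by
  refine ⟨Set.range_eq_univ.mp ?_⟩
  obtain ⟨t⟩ : Nonempty T.left := inferInstance
  refine eq_univ_of_isClopen G T _ ⟨(Scheme.Hom.isClosedEmbedding _).isClosed_range, ?_⟩ t ?_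
  · refine isOpen_iff_forall_mem_open.mpr fun s hs ↦ ?_
    obtain ⟨U, hU, hsU, hUs⟩ := exists_isOpen_mem_range_equalizer G f x x' s hs
    exact ⟨U, hUs, hU, hsU⟩
  · have h : unitSection G T ≫ G ◁ x ≫ γ[G, X] ≫ f = unitSection G T ≫ G ◁ x' ≫ γ[G, X] ≫ f := by
      simpa [reassoc_of% unitSection_naturality G] using hx
    refine ⟨(equalizer.lift _ h).left t, ?_⟩
    rw [← Scheme.Hom.comp_apply, ← Over.comp_left, equalizer.lift_ι]

/-- The action preserves the relation of lying in the same fibre of `f`, on points with values in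
an integral extension of the base field. -/
lemma smul_comp_eq_smul_comp [ConnectedSpace G.left] [IsSeparated Y.hom]
    {T : Over (Spec (.of k))} [Subsingleton T.left] [IsIntegral T.left] [IsIntegralHom T.hom]
    (g : T ⟶ G) (x x' : T ⟶ X) (hx : x ≫ f = x' ≫ f) : (g • x) ≫ f = (g • x') ≫ f := by
  have := surjective_equalizer_ι G f x x' hx
  set v := G ◁ x ≫ γ[G, X] ≫ f with hv
  set v' := G ◁ x' ≫ γ[G, X] ≫ f with hv'
  have h₁ (x : T ⟶ X) : (g • x) ≫ f = lift g (𝟙 T) ≫ G ◁ x ≫ γ[G, X] ≫ f := by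
    simp [Hom.smul_def]
  rw [h₁, h₁, ← hv, ← hv']
  ext1
  -- The equalizer is all of `G ⊗ T` only as a set; `T` is reduced and `Y` separated, so its
  -- pullback along `(g, 1)` suffices.
  refine ext_of_isDominant_of_isSeparated Y.hom (by simp)
    (pullback.fst (lift g (𝟙 T)).left (equalizer.ι v v').left) ?_
  have h := congr($(equalizer.condition v v').left)
  simp only [Over.comp_left] at h ⊢
  rw [pullback.condition_assoc, pullback.condition_assoc, h]

end Action

/-! ### Reduction to closed points and descent of the action -/

lemma isIntegralHom_fromSpecResidueField_comp {Q : Scheme.{u}} (h : Q ⟶ Spec (.of k))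
    [LocallyOfFiniteType h] (q : Q) (hq : IsClosed {q}) :
    IsIntegralHom (Q.fromSpecResidueField q ≫ h) := by
  have : IsFinite (Q.fromSpecResidueField q ≫ h) := by
    rw [isClosed_singleton_iff_isClosedImmersion] at hq
    rw [isFinite_iff_locallyOfFiniteType_of_jacobsonSpace]
    infer_instance
  infer_instance

/-- Morphisms to a separated scheme which agree on all closed points (as morphisms from the residue
fields) agree topologically. -/
lemma apply_eq_of_fromSpecResidueField_comp_eq {Q Y : Over (Spec (.of k))}
    [LocallyOfFiniteType Q.hom] [IsSeparated Y.hom] (u v : Q ⟶ Y)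
    (h : ∀ q : Q.left, IsClosed {q} →
      Q.left.fromSpecResidueField q ≫ u.left = Q.left.fromSpecResidueField q ≫ v.left)
    (q : Q.left) : u.left q = v.left q := by
  have : JacobsonSpace Q.left := LocallyOfFiniteType.jacobsonSpace (Y := Spec _) Q.hom
  have hcl : IsClosed (Set.range (equalizer.ι u v).left) :=
    (Scheme.Hom.isClosedEmbedding _).isClosed_range
  have hsub : closedPoints Q.left ⊆ Set.range (equalizer.ι u v).left := by
    intro q hq
    let L : Over (Spec (.of k)) := Over.mk (Q.left.fromSpecResidueField q ≫ Q.hom)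
    let i : L ⟶ Q := Over.homMk (Q.left.fromSpecResidueField q) rfl
    have hi : i ≫ u = i ≫ v := by
      ext1
      exact h q hq
    let pt : L.left := IsLocalRing.closedPoint _
    have h₁ := congr($(equalizer.lift_ι _ hi).left pt)
    exact ⟨(equalizer.lift _ hi).left pt, h₁.trans (Q.left.fromSpecResidueField_apply q pt)⟩
  have huniv := hcl.closure_subset_iff.mpr hsub
  rw [closure_closedPoints] at huniv
  obtain ⟨e, rfl⟩ := huniv (Set.mem_univ q)
  exact congr($(equalizer.condition u v).left e)

section Descent

variable (G : Over (Spec (.of k))) [GrpObj G] [LocallyOfFiniteType G.hom] [ConnectedSpace G.left]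
  {X Y : Over (Spec (.of k))} [LocallyOfFiniteType X.hom] [ModObj G X] [IsSeparated Y.hom]
  (f : X ⟶ Y) [IsProper f.left] [OConnected f.left]

lemma smul_comp_apply_eq_of_whiskerLeft_apply_eq (a a' : (G ⊗ X).left)
    (h : (G ◁ f).left a = (G ◁ f).left a') :
    (γ[G, X] ≫ f).left a = (γ[G, X] ≫ f).left a' := by
  have : LocallyOfFiniteType (G ⊗ X).hom := by dsimp; infer_instance
  -- `Q` parametrizes pairs in a common fibre of `G ◁ f`; being locally of finite type, it is
  -- controlled by its closed points.
  let Q : Over (Spec (.of k)) :=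
    Over.mk (pullback.fst (G ◁ f).left (G ◁ f).left ≫ (G ⊗ X).hom)
  have : LocallyOfFiniteType Q.hom := by dsimp [Q]; infer_instance
  let p₁ : Q ⟶ G ⊗ X := Over.homMk (pullback.fst _ _) rfl
  let p₂ : Q ⟶ G ⊗ X := Over.homMk (pullback.snd _ _) (by
    change pullback.snd (G ◁ f).left (G ◁ f).left ≫ (G ⊗ X).hom =
      pullback.fst (G ◁ f).left (G ◁ f).left ≫ (G ⊗ X).hom
    rw [← Over.w (G ◁ f), pullback.condition_assoc])
  have hp : p₁ ≫ G ◁ f = p₂ ≫ G ◁ f :=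
    Over.OverMorphism.ext (pullback.condition (f := (G ◁ f).left) (g := (G ◁ f).left))
  obtain ⟨q, rfl, rfl⟩ := Scheme.Pullback.exists_preimage_pullback a a' h
  refine apply_eq_of_fromSpecResidueField_comp_eq (p₁ ≫ γ[G, X] ≫ f) (p₂ ≫ γ[G, X] ≫ f)
    (fun q hq ↦ ?_) q
  let L : Over (Spec (.of k)) := Over.mk (Q.left.fromSpecResidueField q ≫ Q.hom)
  have : IsIntegralHom L.hom := isIntegralHom_fromSpecResidueField_comp Q.hom q hq
  have : Subsingleton L.left :=
    inferInstanceAs (Subsingleton (Spec (Q.left.residueField q)))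
  have : IsIntegral L.left := inferInstanceAs (IsIntegral (Spec (Q.left.residueField q)))
  let i : L ⟶ Q := Over.homMk (Q.left.fromSpecResidueField q) rfl
  have hfst : i ≫ p₁ ≫ fst G X = i ≫ p₂ ≫ fst G X := by
    simpa using congr(i ≫ $hp ≫ fst G Y)
  have hsnd : (i ≫ p₁ ≫ snd G X) ≫ f = (i ≫ p₂ ≫ snd G X) ≫ f := by
    simpa using congr(i ≫ $hp ≫ snd G Y)
  have key := smul_comp_eq_smul_comp G f (i ≫ p₁ ≫ fst G X) _ _ hsnd
  have hr (r : Q ⟶ G ⊗ X) :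
      ((i ≫ r ≫ fst G X) • (i ≫ r ≫ snd G X)) ≫ f = i ≫ r ≫ γ[G, X] ≫ f := by
    rw [Hom.smul_def, ← comp_lift, ← comp_lift]
    simp
  have key' : i ≫ p₁ ≫ γ[G, X] ≫ f = i ≫ p₂ ≫ γ[G, X] ≫ f := by
    rw [← hr, ← hr, key, hfst]
  exact congr($(key').left)

/-- The morphism `G ⊗ X ⟶ X ⟶ Y` descends to `G ⊗ Y`. -/
lemma exists_whiskerLeft_comp_eq_smul_comp : ∃ b : G ⊗ Y ⟶ Y, G ◁ f ≫ b = γ[G, X] ≫ f := by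
  obtain ⟨b, hb⟩ := OConnected.exists_comp_eq (G ◁ f).left (γ[G, X] ≫ f).left
    (smul_comp_apply_eq_of_whiskerLeft_apply_eq G f)
  have := OConnected.epi (G ◁ f).left
  refine ⟨Over.homMk b ?_, ?_⟩
  · rw [← cancel_epi (G ◁ f).left, reassoc_of% hb, Over.w, Over.w]
    rfl
  · ext1
    exact hb

end Descent

end AlgebraicGeometry

open MonoidalCategory CartesianMonoidalCategory in
open scoped CategoryTheory.MonObj in
theorem mainTheorem11 {k : Type u} [Field k]
    (G : Over (Spec (CommRingCat.of k))) [GrpObj G]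
    [LocallyOfFiniteType G.hom] [QuasiCompact G.hom] [ConnectedSpace G.left]
    (X : Over (Spec (CommRingCat.of k)))
    [IsSeparated X.hom] [LocallyOfFiniteType X.hom] [QuasiCompact X.hom] [ModObj G X]
    (Y : Over (Spec (CommRingCat.of k)))
    [IsSeparated Y.hom] [LocallyOfFiniteType Y.hom] [QuasiCompact Y.hom]
    (f : X ⟶ Y) [IsProper f.left] (hf : IsIso f.left.c) :
    ∃! _ : ModObj G Y, IsModHom G f := by
  have : OConnected f.left := .of_isIso_c _ hf
  obtain ⟨b, hb⟩ := exists_whiskerLeft_comp_eq_smul_comp G f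
  have hGf : Epi (G ◁ f) := epi_of_oConnected (G ◁ f)
  have h1f : Epi (𝟙_ _ ◁ f) := epi_of_oConnected (𝟙_ _ ◁ f)
  have hGGf : Epi ((G ⊗ G) ◁ f) := epi_of_oConnected ((G ⊗ G) ◁ f)
  have hone : η[G] ▷ Y ≫ b = (λ_ Y).hom := by
    rw [← cancel_epi (𝟙_ _ ◁ f), whisker_exchange_assoc, hb, ModObj.one_smul_self_assoc]
    simp
  have hmul : μ[G] ▷ Y ≫ b = (α_ G G Y).hom ≫ G ◁ b ≫ b := by
    rw [← cancel_epi ((G ⊗ G) ◁ f), whisker_exchange_assoc, hb, ModObj.mul_smul_self_assoc]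
    simp [← MonoidalCategory.whiskerLeft_comp_assoc, hb]
  let M : ModObj G Y := ⟨b, hone, hmul⟩
  refine ⟨M, ⟨hb.symm⟩, fun M' hM' ↦ ModObj.ext _ _ ?_⟩
  rw [← cancel_epi (G ◁ f)]
  exact hM'.smul_hom.symm.trans hb.symm
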